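/- Let $\mathcal G$ be a weakly connected weighted digraph on the vertices $1,\dots,n$ with weights $w_{ij}\ge 0$ (there is an edge, with information flowing from $j$ to $i$, iff $w_{ij}>0$), let $\mathcal L=\mathrm{diag}(W\mathbf 1)-W$, where $W=(w_{ij})$, be its Laplacian matrix, and consider the network system $\dot x=-\mathcal Lx+Fu$, $y=Hx$ with $F\in\mathbb R^{n\times p}$ and $H\in\mathbb R^{q\times n}$. Let $M$ be a positive diagonal matrix such that $L:=M\mathcal L$ is the Laplacian matrix of a generalized balanced digraph, i.e. of a weakly connected weighted digraph with weights $w'_{ij}$ such that $\sum_{j\in S}w'_{ij}=\sum_{j\in S}w'_{ji}$ for every strongly connected component $S$ without incoming edges and every $i\in S$. Put $\mathbf e_{ij}=\mathbf e_i-\mathbf e_j$. Vertices $i,j$ are called clusterable if $\mathbf e_{ij}\in\ker(L)^\perp$ and $\mathbf e_{ij}\in\ker(L^T)^\perp$. Their dissimilarity is $$\mathcal D_{ij}=\mathcal D^I_{ij}\,\mathcal D^O_{ij},\qquad \mathcal D^I_{ij}=\|\mathbf e_{ij}^T(sM+L)^{-1}MF\|_{\mathcal H_2},\qquad \mathcal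 D^O_{ij}=\|H(sM+L)^{-1}\mathbf e_{ij}\|_{\mathcal H_2},$$ where $\|G\|_{\mathcal H_2}^2=\sup_{\sigma>0}\frac1{2\pi}\int_{-\infty}^{\infty}\mathrm{tr}\big(G(\sigma+\mathrm i\omega)^*G(\sigma+\mathrm i\omega)\big)\,d\omega$. The pseudo controllability and observability Gramians of the system are, with $A=-\mathcal L$ and $\mathcal J=\lim_{\tau\to\infty}e^{A\tau}$, $$\mathcal P=\int_0^\infty(e^{A\tau}-\mathcal J)FF^T(e^{A^T\tau}-\mathcal J^T)\,d\tau,\qquad \mathcal Q=\int_0^\infty(e^{A^T\tau}-\mathcal J^T)H^TH(e^{A\tau}-\mathcal J)\,d\tau .$$ Theorem. The limit $\mathcal J$ exists, the integrals defining $\mathcal P$ and $\mathcal Q$ converge absolutely, and $sM+L$ is invertible for $\mathrm{Re}\,s>0$. If $i,j$ are clusterable, then both transfer functions above belong to $\mathcal H_2$ (they are holomorphic for $\mathrm{Re}\,s>0$ with finite $\mathcal H_2$ norm), the numbers $\mathbf e_{ij}^T\mathcal P\mathbf e_{ij}$ and $\mathbf e_{ij}^TM^{-1}\mathcal QM^{-1}\mathbf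 e_{ij}$ are nonnegative, and $$\mathcal D_{ij}=\sqrt{\mathbf e_{ij}^T\mathcal P\mathbf e_{ij}\cdot\mathbf e_{ij}^TM^{-1}\mathcal QM^{-1}\mathbf e_{ij}} .$$ -/

import Mathlib

open Matrix Filter Topology MeasureTheory
open scoped ENNReal

noncomputable section

/-- A weighted digraph on the vertices `Fin n`. The pair `(i, j)` is an edge, along which
information flows from `j` to `i`, exactly when the weight `w i j` is positive. -/
structure WeightedDigraph (n : ℕ) where
  w : Matrix (Fin n) (Fin n) ℝ
  w_nonneg : ∀ i j, 0 ≤ w i j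

namespace WeightedDigraph

variable {n : ℕ}

/-- The Laplacian matrix `diag(W 1) - W`. -/
def laplacian (G : WeightedDigraph n) : Matrix (Fin n) (Fin n) ℝ :=
  Matrix.diagonal (fun i => ∑ j, G.w i j) - G.w

/-- Any two vertices are joined by an undirected path. -/
def WeaklyConnected (G : WeightedDigraph n) : Prop :=
  ∀ i j, Relation.ReflTransGen (fun a b => 0 < G.w a b ∨ 0 < G.w b a) i j

/-- There is a directed path (along the information flow, possibly of length zero)
from `i` to `j`. -/
def Reaches (G : WeightedDigraph n) (i j : Fin n) : Prop :=
  Relation.ReflTransGen (fun a b => 0 < G.w b a) i j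

/-- `S` is the vertex set of a strongly connected component. -/
def IsSCC (G : WeightedDigraph n) (S : Finset (Fin n)) : Prop :=
  ∃ i, ∀ k, k ∈ S ↔ G.Reaches i k ∧ G.Reaches k i

/-- `S` is the vertex set of a leading strongly connected component: no edge enters `S`
from outside. -/
def IsLSCC (G : WeightedDigraph n) (S : Finset (Fin n)) : Prop :=
  G.IsSCC S ∧ ∀ i ∈ S, ∀ j, j ∉ S → G.w i j = 0

/-- A weakly connected digraph all of whose leading strongly connected components are
balanced. -/
def GeneralizedBalanced (G : WeightedDigraph n) : Prop :=
  G.WeaklyConnected ∧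
    ∀ S, G.IsLSCC S → ∀ i ∈ S, ∑ j ∈ S, G.w i j = ∑ j ∈ S, G.w j i

end WeightedDigraph

section Gramians

variable {n p q : ℕ}

/-- The matrix `𝒥 = lim_{τ → ∞} exp (A τ)`. -/
def limitMatrix (A : Matrix (Fin n) (Fin n) ℝ) : Matrix (Fin n) (Fin n) ℝ :=
  limUnder atTop (fun τ : ℝ => NormedSpace.exp (τ • A))

/-- The integrand `(exp (A τ) - 𝒥) B Bᵀ (exp (Aᵀ τ) - 𝒥ᵀ)`. -/
def ctrlIntegrand (A : Matrix (Fin n) (Fin n) ℝ) (B : Matrix (Fin n) (Fin p) ℝ) (τ : ℝ) :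
    Matrix (Fin n) (Fin n) ℝ :=
  (NormedSpace.exp (τ • A) - limitMatrix A) * B * Bᵀ *
    (NormedSpace.exp (τ • Aᵀ) - (limitMatrix A)ᵀ)

/-- The integrand `(exp (Aᵀ τ) - 𝒥ᵀ) Cᵀ C (exp (A τ) - 𝒥)`. -/
def obsvIntegrand (A : Matrix (Fin n) (Fin n) ℝ) (C : Matrix (Fin q) (Fin n) ℝ) (τ : ℝ) :
    Matrix (Fin n) (Fin n) ℝ :=
  (NormedSpace.exp (τ • Aᵀ) - (limitMatrix A)ᵀ) * Cᵀ * C *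
    (NormedSpace.exp (τ • A) - limitMatrix A)

/-- The pseudo controllability Gramian `𝒫` of `x' = A x + B u` (entrywise integral). -/
def pseudoCtrlGramian (A : Matrix (Fin n) (Fin n) ℝ) (B : Matrix (Fin n) (Fin p) ℝ) :
    Matrix (Fin n) (Fin n) ℝ :=
  Matrix.of fun k l => ∫ τ in Set.Ioi (0 : ℝ), ctrlIntegrand A B τ k l

/-- The pseudo observability Gramian `𝒬` of `x' = A x`, `y = C x` (entrywise integral). -/
def pseudoObsvGramian (A : Matrix (Fin n) (Fin n) ℝ) (C : Matrix (Fin q) (Fin n) ℝ) :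
    Matrix (Fin n) (Fin n) ℝ :=
  Matrix.of fun k l => ∫ τ in Set.Ioi (0 : ℝ), obsvIntegrand A C τ k l

end Gramians

section Hardy

variable {ι κ : Type} [Fintype ι] [Fintype κ]

/-- The `ℋ₂` norm of a matrix-valued function on the open right half plane,
`(sup_{σ > 0} (1 / 2π) ∫ ‖G (σ + i ω)‖_F² dω) ^ (1/2)`, with value `∞` allowed;
`‖·‖_F` is the Frobenius norm, `‖X‖_F² = tr (X* X)`. -/
def h2Norm (G : ℂ → Matrix ι κ ℂ) : ℝ≥0∞ :=
  (⨆ (σ : ℝ) (_ : 0 < σ), ENNReal.ofReal (1 / (2 * Real.pi)) *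
    ∫⁻ ω : ℝ, ∑ a, ∑ b, ‖G ((σ : ℂ) + (ω : ℂ) * Complex.I) a b‖ₑ ^ 2) ^ (1 / 2 : ℝ)

/-- Membership in the Hardy space `ℋ₂`: holomorphic on the open right half plane, with finite
`ℋ₂` norm. -/
def MemH2 (G : ℂ → Matrix ι κ ℂ) : Prop :=
  (∀ a b, DifferentiableOn ℂ (fun s => G s a b) {s : ℂ | 0 < s.re}) ∧ h2Norm G < ⊤

end Hardy

/-- The directed network system `x' = -ℒ x + F u`, `y = H x`, with `ℒ` the Laplacian matrix of
a weighted digraph. -/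
structure NetworkSystem (n p q : ℕ) where
  graph : WeightedDigraph n
  F : Matrix (Fin n) (Fin p) ℝ
  H : Matrix (Fin q) (Fin n) ℝ

namespace NetworkSystem

variable {n p q : ℕ} (Sys : NetworkSystem n p q) (m : Fin n → ℝ)

/-- The Laplacian `L = M ℒ` of the form `M x' = -L x + M F u`, `y = H x`, for
`M = diag m`. -/
def L : Matrix (Fin n) (Fin n) ℝ :=
  Matrix.diagonal m * Sys.graph.laplacian

/-- `M = diag m` yields a generalized balanced form of the system: `M` is positive and `M ℒ` is
the Laplacian matrix of a generalized balanced digraph. -/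
def IsGeneralizedBalancedForm : Prop :=
  (∀ i, 0 < m i) ∧
    ∃ G : WeightedDigraph n, G.GeneralizedBalanced ∧ Sys.L m = G.laplacian

end NetworkSystem

/-- The vector `e_{ij} = e_i - e_j`. -/
def eDiff {n : ℕ} (i j : Fin n) : Fin n → ℝ :=
  Pi.single i 1 - Pi.single j 1

namespace NetworkSystem

variable {n p q : ℕ} (Sys : NetworkSystem n p q) (m : Fin n → ℝ)

/-- `e_{ij} ∈ ker(L)^⊥` and `e_{ij} ∈ ker(Lᵀ)^⊥`. -/
def Clusterable (i j : Fin n) : Prop :=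
  (∀ v : Fin n → ℝ, Sys.L m *ᵥ v = 0 → eDiff i j ⬝ᵥ v = 0) ∧
    (∀ v : Fin n → ℝ, (Sys.L m)ᵀ *ᵥ v = 0 → eDiff i j ⬝ᵥ v = 0)

/-- The complex matrix `s M + L`. -/
def pencil (s : ℂ) : Matrix (Fin n) (Fin n) ℂ :=
  s • (Matrix.diagonal m).map Complex.ofReal + (Sys.L m).map Complex.ofReal

/-- The transfer function `e_{ij}ᵀ (s M + L)⁻¹ M F`. -/
def inputTransfer (i j : Fin n) (s : ℂ) : Matrix Unit (Fin p) ℂ :=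
  (replicateRow Unit (eDiff i j)).map Complex.ofReal * (Sys.pencil m s)⁻¹ *
    (Matrix.diagonal m * Sys.F).map Complex.ofReal

/-- The transfer function `H (s M + L)⁻¹ e_{ij}`. -/
def outputTransfer (i j : Fin n) (s : ℂ) : Matrix (Fin q) Unit ℂ :=
  Sys.H.map Complex.ofReal * (Sys.pencil m s)⁻¹ *
    (replicateCol Unit (eDiff i j)).map Complex.ofReal

/-- The input dissimilarity `𝒟ᴵ_{ij}`. -/
def inputDissimilarity (i j : Fin n) : ℝ≥0∞ := h2Norm (Sys.inputTransfer m i j)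

/-- The output dissimilarity `𝒟ᴼ_{ij}`. -/
def outputDissimilarity (i j : Fin n) : ℝ≥0∞ := h2Norm (Sys.outputTransfer m i j)

/-- The dissimilarity `𝒟_{ij} = 𝒟ᴵ_{ij} 𝒟ᴼ_{ij}`. -/
def dissimilarity (i j : Fin n) : ℝ≥0∞ :=
  Sys.inputDissimilarity m i j * Sys.outputDissimilarity m i j

/-- The pseudo controllability Gramian of the network system. -/
def P : Matrix (Fin n) (Fin n) ℝ := pseudoCtrlGramian (-Sys.graph.laplacian) Sys.F

/-- The pseudo observability Gramian of the network system. -/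
def Q : Matrix (Fin n) (Fin n) ℝ := pseudoObsvGramian (-Sys.graph.laplacian) Sys.H

end NetworkSystem

end

/-!
The formula is Parseval's identity for the impulse responses of the system.

Put `A = -ℒ`. Since `s M + L = M (s - A)`, the two transfer functions are `eᵀ (s - A)⁻¹ F` and
`H (s - A)⁻¹ v`, where `e = e_{ij}` and `v = M⁻¹ e`. The semigroup `exp (t A)` is bounded on
`t ≥ 0`, so its Laplace transform exists for `Re s > 0` and is the resolvent `(s - A)⁻¹`
(`Matrix.laplace_exp_mul`). Plancherel's theorem on the line `Re s = σ` followed by the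
limit `σ → 0` identifies the squared `ℋ₂` norms with the squared `L²` norms of
`eᵀ exp (t A) F` and `H exp (t A) v` on the half line (`h2Norm_eq_lintegral`).
The limit `J` of `exp (t A)` satisfies `A J = J A = 0`. Orthogonality of `e` to `ker L` gives
`eᵀ J = 0`, and orthogonality to `ker Lᵀ = M⁻¹ ker ℒᵀ` gives `J v = 0`; hence `exp (t A)` may be
replaced by `exp (t A) - J` in both responses, and their squared `L²` norms are the quadratic forms
of the pseudo Gramians at `e` and `v` (`dotProduct_gramian_mulVec`).

The existence of `J` and the convergence of all integrals rest on exponential convergence of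
`exp (t A)` (`Matrix.exists_exp_sub_le`). It holds because the nonzero eigenvalues of `A` have
negative real part, by Gershgorin's theorem, and because the eigenvalue `0` is semisimple, the
matrix `1 + h A` being stochastic for small `h > 0`; the trajectories are then examined on each
generalized eigenspace.

Plancherel's theorem for functions in `L¹ ∩ L²` is obtained by comparing the Fourier integral with
the Fourier transform of `L²` as tempered distributions (`MeasureTheory.MemLp.coeFn_fourier_toLp`).
-/

/-! ### Exponential convergence of matrix semigroups -/

section ExponentialDecay

attribute [local instance] Matrix.linftyOpNormedRing Matrix.linftyOpNormedAlgebra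

theorem Matrix.exp_smul_mulVec_of_pow_mulVec_eq_zero {n : ℕ} (N : Matrix (Fin n) (Fin n) ℂ)
    (v : Fin n → ℂ) {K : ℕ} (hK : (N ^ K) *ᵥ v = 0) (t : ℂ) :
    NormedSpace.exp (t • N) *ᵥ v =
      ∑ k ∈ Finset.range K, (t ^ k / (k.factorial : ℂ)) • ((N ^ k) *ᵥ v) := by
  have h1 : HasSum (fun k : ℕ => ((k.factorial : ℂ)⁻¹) • (t • N) ^ k)
      (NormedSpace.exp (t • N)) := NormedSpace.exp_series_hasSum_exp' (𝕂 := ℂ) (t • N)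
  have hc : Continuous fun X : Matrix (Fin n) (Fin n) ℂ => X *ᵥ v := by fun_prop
  have h2 := h1.map (Matrix.mulVecBilin ℂ ℂ |>.flip v) hc
  refine h2.unique ?_
  have h3 : ∀ k ∉ Finset.range K, ((Matrix.mulVecBilin ℂ ℂ |>.flip v) ∘
      fun k : ℕ => ((k.factorial : ℂ)⁻¹) • (t • N) ^ k) k = 0 := by
    intro k hk
    obtain ⟨l, rfl⟩ := Nat.exists_eq_add_of_le (not_lt.1 (Finset.mem_range.not.1 hk))
    simp [smul_pow, add_comm K l, pow_add, hK]
  have h4 : ∀ k : ℕ, (t ^ k / (k.factorial : ℂ)) • ((N ^ k) *ᵥ v) =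
      ((Matrix.mulVecBilin ℂ ℂ |>.flip v) ∘
        fun k : ℕ => ((k.factorial : ℂ)⁻¹) • (t • N) ^ k) k := by
    intro k
    simp [smul_pow, smul_smul, div_eq_inv_mul]
  rw [Finset.sum_congr rfl fun k _ => h4 k]
  exact hasSum_sum_of_ne_finset_zero h3

/-- The trajectory `exp (t B) v` converges exponentially fast as `t → ∞`. -/
def Matrix.ExpConverges {n : ℕ} (B : Matrix (Fin n) (Fin n) ℂ) (v : Fin n → ℂ) : Prop :=
  ∃ w : Fin n → ℂ, ∃ C ε : ℝ, 0 < ε ∧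
    ∀ t : ℝ, 0 ≤ t → ‖NormedSpace.exp ((t : ℂ) • B) *ᵥ v - w‖ ≤ C * Real.exp (-ε * t)

theorem Matrix.ExpConverges.add {n : ℕ} {B : Matrix (Fin n) (Fin n) ℂ} {v v' : Fin n → ℂ}
    (h : B.ExpConverges v) (h' : B.ExpConverges v') : B.ExpConverges (v + v') := by
  obtain ⟨w, C, ε, hε, h⟩ := h
  obtain ⟨w', C', ε', hε', h'⟩ := h'
  refine ⟨w + w', |C| + |C'|, min ε ε', lt_min hε hε', fun t ht => ?_⟩
  have e1 : Real.exp (-ε * t) ≤ Real.exp (-(min ε ε') * t) := by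
    gcongr; exact min_le_left _ _
  have e2 : Real.exp (-ε' * t) ≤ Real.exp (-(min ε ε') * t) := by
    gcongr; exact min_le_right _ _
  rw [mulVec_add, add_sub_add_comm, add_mul]
  refine (norm_add_le _ _).trans (add_le_add ?_ ?_)
  · exact (h t ht).trans (mul_le_mul (le_abs_self _) e1 (by positivity) (abs_nonneg _))
  · exact (h' t ht).trans (mul_le_mul (le_abs_self _) e2 (by positivity) (abs_nonneg _))

theorem Matrix.exp_add_smul_one {n : ℕ} (N : Matrix (Fin n) (Fin n) ℂ) (a : ℂ) :
    NormedSpace.exp (N + a • (1 : Matrix (Fin n) (Fin n) ℂ)) =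
      Complex.exp a • NormedSpace.exp N := by
  rw [Matrix.exp_add_of_commute]
  · have : NormedSpace.exp (a • (1 : Matrix (Fin n) (Fin n) ℂ)) =
        Complex.exp a • (1 : Matrix (Fin n) (Fin n) ℂ) := by
      rw [← Algebra.algebraMap_eq_smul_one, ← Algebra.algebraMap_eq_smul_one,
        Complex.exp_eq_exp_ℂ]
      exact (NormedSpace.algebraMap_exp_comm a).symm
    rw [this]; simp
  · exact (Commute.one_right N).smul_right a

/-- A generalized eigenvector of an eigenvalue with negative real part decays exponentially:
its trajectory is `exp (μ t)` times a polynomial in `t`. -/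
theorem Matrix.expConverges_of_re_neg {n : ℕ} {B : Matrix (Fin n) (Fin n) ℂ} {v : Fin n → ℂ}
    {μ : ℂ} (hμ : μ.re < 0) {K : ℕ}
    (hK : ((B - μ • (1 : Matrix (Fin n) (Fin n) ℂ)) ^ K) *ᵥ v = 0) : B.ExpConverges v := by
  set N := B - μ • (1 : Matrix (Fin n) (Fin n) ℂ) with hN
  -- Half of the decay rate absorbs the polynomial factor, by `(a t) ^ k / k! ≤ exp (a t)`.
  set a : ℝ := -μ.re / 2 with ha
  have ha0 : 0 < a := by simp only [ha]; linarith
  refine ⟨0, ∑ k ∈ Finset.range K, a⁻¹ ^ k * ‖(N ^ k) *ᵥ v‖, a, ha0, fun t ht => ?_⟩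
  have e : (t : ℂ) • B = (t : ℂ) • N + ((t : ℂ) * μ) • (1 : Matrix (Fin n) (Fin n) ℂ) := by
    rw [hN, smul_sub, smul_smul, sub_add_cancel]
  rw [sub_zero, e, exp_add_smul_one, smul_mulVec, norm_smul,
    exp_smul_mulVec_of_pow_mulVec_eq_zero N v hK, Complex.norm_exp]
  have hre : ((t : ℂ) * μ).re = -a * t + -(a * t) := by
    simp [ha]; ring
  rw [hre, Real.exp_add, Finset.sum_mul]
  calc _ ≤ Real.exp (-a * t) * Real.exp (-(a * t)) *
        ∑ k ∈ Finset.range K, (t ^ k / (k.factorial : ℝ)) * ‖(N ^ k) *ᵥ v‖ := by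
        gcongr
        refine (norm_sum_le _ _).trans (Finset.sum_le_sum fun k _ => ?_)
        rw [norm_smul]
        simp [abs_of_nonneg ht]
    _ = ∑ k ∈ Finset.range K, (Real.exp (-(a * t)) * (t ^ k / (k.factorial : ℝ))) *
          ‖(N ^ k) *ᵥ v‖ * Real.exp (-a * t) := by
        rw [Finset.mul_sum]
        exact Finset.sum_congr rfl fun k _ => by ring
    _ ≤ _ := by
        refine Finset.sum_le_sum fun k _ => ?_
        gcongr
        have := Real.pow_div_factorial_le_exp (a * t) (by positivity) k
        rw [Real.exp_neg, inv_pow, ← div_eq_inv_mul, div_le_iff₀ (Real.exp_pos _),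
          ← div_eq_inv_mul, le_div_iff₀ (by positivity)]
        calc _ = (a * t) ^ k / (k.factorial : ℝ) := by rw [mul_pow]; ring
          _ ≤ _ := this

/-- If all nonzero eigenvalues have negative real part and the eigenvalue `0` is semisimple, all
trajectories of `x' = B x` converge exponentially. -/
theorem Matrix.expConverges_of_eigenvalues {n : ℕ} {B : Matrix (Fin n) (Fin n) ℂ}
    (hB : ∀ μ, Module.End.HasEigenvalue (Matrix.toLin' B) μ → μ = 0 ∨ μ.re < 0)
    (h0 : ∀ v, B *ᵥ (B *ᵥ v) = 0 → B *ᵥ v = 0) (v : Fin n → ℂ) : B.ExpConverges v := by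
  have hv : v ∈ ⨆ μ : ℂ, Module.End.maxGenEigenspace (Matrix.toLin' B) μ := by
    rw [Module.End.iSup_maxGenEigenspace_eq_top]; trivial
  have hzero : B.ExpConverges 0 := ⟨0, 0, 1, one_pos, fun t _ => by simp⟩
  induction hv using Submodule.iSup_induction' with
  | zero => exact hzero
  | add x y _ _ hx hy => exact hx.add hy
  | mem μ x hx =>
    by_cases hx0 : x = 0
    · rw [hx0]; exact hzero
    obtain ⟨K, hK⟩ := Module.End.mem_maxGenEigenspace _ _ _ |>.1 hx
    have hK' : ((B - μ • (1 : Matrix (Fin n) (Fin n) ℂ)) ^ K) *ᵥ x = 0 := by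
      rw [← hK, ← Matrix.toLin'_apply, Matrix.toLin'_pow, map_sub, map_smul, Matrix.toLin'_one]
      rfl
    have hev : Module.End.HasEigenvalue (Matrix.toLin' B) μ := by
      refine Module.End.HasUnifEigenvalue.lt zero_lt_one (k := ⊤) ?_
      intro hbot
      rw [Module.End.maxGenEigenspace, hbot] at hx
      exact hx0 ((Submodule.mem_bot ℂ).1 hx)
    rcases hB μ hev with rfl | hμ
    · have hker : ∀ k : ℕ, (B ^ k) *ᵥ x = 0 → B *ᵥ x = 0 := by
        intro k
        induction k with
        | zero => intro h; simp at h; simp [h]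
        | succ k ih =>
          cases k with
          | zero => intro h; simpa using h
          | succ k =>
            intro h
            refine ih ?_
            rw [pow_succ', ← mulVec_mulVec]
            apply h0
            rw [← h, mulVec_mulVec, mulVec_mulVec, pow_succ', pow_succ', mul_assoc]
      rw [zero_smul, sub_zero] at hK'
      have h1 : (B ^ 1) *ᵥ x = 0 := by rw [pow_one]; exact hker K hK'
      refine ⟨x, 0, 1, one_pos, fun t _ => ?_⟩
      rw [exp_smul_mulVec_of_pow_mulVec_eq_zero B x h1]
      simp
    · exact expConverges_of_re_neg hμ hK'

end ExponentialDecay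

/-! ### Plancherel's theorem on `L¹ ∩ L²` -/

section Plancherel

open SchwartzMap FourierTransform

variable {V E : Type*} [NormedAddCommGroup V] [InnerProductSpace ℝ V] [FiniteDimensional ℝ V]
  [MeasurableSpace V] [BorelSpace V] [NormedAddCommGroup E] [InnerProductSpace ℂ E]
  [CompleteSpace E]

/-- On `L¹ ∩ L²` the Fourier transform of `L²` is given by the Fourier integral. -/
theorem MeasureTheory.MemLp.coeFn_fourier_toLp {f : V → E} (hf : MemLp f 2) (hf1 : Integrable f) :
    ⇑(𝓕 (hf.toLp f) : Lp E 2 (volume : Measure V)) =ᵐ[volume] 𝓕 f := by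
  have hcont : Continuous (𝓕 f) :=
    VectorFourier.fourierIntegral_continuous Real.continuous_fourierChar
      (by exact continuous_inner) hf1
  refine ae_eq_of_integral_contDiff_smul_eq
    ((Lp.memLp (𝓕 (hf.toLp f) : Lp E 2 (volume : Measure V))).locallyIntegrable (by norm_num))
    hcont.locallyIntegrable ?_
  intro g hg hgc
  have hgc' : HasCompactSupport (fun x => (g x : ℂ)) := hgc.comp_left (g := Complex.ofReal) rfl
  let φ : 𝓢(V, ℂ) := hgc'.toSchwartzMap (Complex.ofRealCLM.contDiff.comp hg)
  have hφ : ∀ x, φ x = (g x : ℂ) := fun x => rfl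
  -- Both sides are the tempered distribution `𝓕 f` tested against `g`.
  have h := congrArg (fun T : 𝓢'(V, E) => T φ) (Lp.fourier_toTemperedDistribution_eq (hf.toLp f))
  simp only [TemperedDistribution.fourier_apply, Lp.toTemperedDistribution_apply] at h
  have h1 : ∀ (u : V → E), ∫ x, g x • u x = ∫ x, φ x • u x := fun u =>
    integral_congr_ae (Eventually.of_forall fun x => by simp only [hφ, Complex.coe_smul])
  rw [h1, h1, ← h]
  have h2 : ∫ x, (𝓕 φ) x • (hf.toLp f) x = ∫ x, (𝓕 φ) x • f x := by
    refine integral_congr_ae ?_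
    filter_upwards [hf.coeFn_toLp] with x hx
    rw [hx]
  rw [h2, SchwartzMap.fourier_coe]
  have := VectorFourier.integral_fourierIntegral_smul_eq_flip (L := innerₗ V)
    (μ := volume) (ν := volume) Real.continuous_fourierChar (by exact continuous_inner)
    φ.integrable hf1
  rw [flip_innerₗ] at this
  exact this

/-- **Plancherel's theorem** for functions in `L¹ ∩ L²`. -/
theorem MeasureTheory.MemLp.lintegral_enorm_fourier_sq {f : V → E} (hf : MemLp f 2)
    (hf1 : Integrable f) : ∫⁻ ξ, ‖𝓕 f ξ‖ₑ ^ 2 = ∫⁻ x, ‖f x‖ₑ ^ 2 := by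
  have key : eLpNorm (𝓕 f) 2 volume = eLpNorm f 2 volume := by
    rw [← eLpNorm_congr_ae (hf.coeFn_fourier_toLp hf1), ← eLpNorm_congr_ae hf.coeFn_toLp,
      ← Lp.enorm_def, ← Lp.enorm_def, ← ofReal_norm, ← ofReal_norm, Lp.norm_fourier_eq]
  have h : ∀ u : V → E, ∫⁻ x, ‖u x‖ₑ ^ 2 = eLpNorm u 2 volume ^ 2 := by
    intro u
    rw [eLpNorm_eq_lintegral_rpow_enorm_toReal two_ne_zero ENNReal.ofNat_ne_top,
      ← ENNReal.rpow_natCast, ← ENNReal.rpow_mul]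
    simp
  rw [h, h, key]

end Plancherel

/-! ### Metzler matrices with zero row sums -/

section Compartmental

variable {n : ℕ} {A : Matrix (Fin n) (Fin n) ℝ}

theorem Matrix.sum_erase_eq_neg_diag (hsum : ∀ k, ∑ l, A k l = 0) (k : Fin n) :
    ∑ l ∈ Finset.univ.erase k, A k l = -A k k := by
  have := Finset.add_sum_erase Finset.univ (fun l => A k l) (Finset.mem_univ k)
  rw [hsum] at this
  linarith

/-- Gershgorin's theorem puts the eigenvalues of a Metzler matrix with zero row sums into discs
that touch the imaginary axis only at `0`. -/
theorem Matrix.eigenvalue_eq_zero_or_re_neg (hoff : ∀ k l, k ≠ l → 0 ≤ A k l)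
    (hsum : ∀ k, ∑ l, A k l = 0) {μ : ℂ}
    (hμ : Module.End.HasEigenvalue (Matrix.toLin' (A.map Complex.ofReal)) μ) :
    μ = 0 ∨ μ.re < 0 := by
  obtain ⟨k, hk⟩ := eigenvalue_mem_ball hμ
  have hr : ∑ j ∈ Finset.univ.erase k, ‖A.map Complex.ofReal k j‖ = -A k k := by
    rw [← sum_erase_eq_neg_diag hsum]
    refine Finset.sum_congr rfl fun l hl => ?_
    simp [abs_of_nonneg (hoff k l (Finset.ne_of_mem_erase hl).symm)]
  rw [hr, mem_closedBall_iff_norm, map_apply] at hk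
  by_contra! hcon
  obtain ⟨hne, hre⟩ := hcon
  have h0 : 0 ≤ -A k k := (norm_nonneg _).trans hk
  have h1 : ‖μ - (A k k : ℂ)‖ ^ 2 ≤ (-A k k) ^ 2 := by gcongr
  rw [← Complex.normSq_eq_norm_sq, Complex.normSq_apply] at h1
  simp only [Complex.sub_re, Complex.ofReal_re, Complex.sub_im, Complex.ofReal_im, sub_zero] at h1
  have h2 : 0 ≤ μ.re * -A k k := mul_nonneg hre h0
  have h3 : μ.re = 0 := by nlinarith [mul_self_nonneg μ.im, mul_self_nonneg μ.re]
  have h4 : μ.im = 0 := by nlinarith [mul_self_nonneg μ.im, mul_self_nonneg μ.re]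
  exact hne (Complex.ext h3 h4)

/-- The eigenvalue `0` of a Metzler matrix with zero row sums is semisimple: the powers of the
stochastic matrix `1 + h A`, for small `h > 0`, are contractions in the supremum norm, whereas
they would grow linearly along a Jordan chain. -/
theorem Matrix.mulVec_eq_zero_of_mulVec_mulVec_eq_zero (hoff : ∀ k l, k ≠ l → 0 ≤ A k l)
    (hsum : ∀ k, ∑ l, A k l = 0) {v : Fin n → ℂ}
    (hv : A.map Complex.ofReal *ᵥ (A.map Complex.ofReal *ᵥ v) = 0) :
    A.map Complex.ofReal *ᵥ v = 0 := by
  set B := A.map Complex.ofReal with hB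
  -- `h` is small enough for the diagonal of `1 + h A` to be nonnegative.
  obtain ⟨h, hpos, hh⟩ : ∃ h : ℝ, 0 < h ∧ ∀ k, 0 ≤ 1 + h * A k k := by
    refine ⟨(1 + ∑ k, |A k k|)⁻¹, by positivity, fun k => ?_⟩
    have h1 : |A k k| ≤ ∑ k, |A k k| :=
      Finset.single_le_sum (f := fun k => |A k k|) (fun _ _ => abs_nonneg _) (Finset.mem_univ k)
    have h2 : (0 : ℝ) < 1 + ∑ k, |A k k| := by positivity
    have h3 := neg_abs_le (A k k)
    have h4 : 1 + (1 + ∑ k, |A k k|)⁻¹ * A k k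
        = ((1 + ∑ k, |A k k|) + A k k) / (1 + ∑ k, |A k k|) := by field_simp
    rw [h4]
    exact div_nonneg (by linarith) h2.le
  set S : Matrix (Fin n) (Fin n) ℝ := 1 + h • A with hS
  have hS0 : ∀ k l, 0 ≤ S k l := by
    intro k l
    by_cases hkl : k = l
    · subst hkl; simpa [hS] using hh k
    · simpa [hS, hkl] using mul_nonneg hpos.le (hoff k l hkl)
  have hS1 : ∀ k, ∑ l, S k l = 1 := by
    intro k
    simp [hS, Finset.sum_add_distrib, ← Finset.mul_sum, hsum, Matrix.one_apply]
  have hcontr : ∀ x : Fin n → ℂ, ‖S.map Complex.ofReal *ᵥ x‖ ≤ ‖x‖ := by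
    intro x
    refine (pi_norm_le_iff_of_nonneg (norm_nonneg _)).2 fun k => ?_
    calc ‖∑ l, (S k l : ℂ) * x l‖ ≤ ∑ l, S k l * ‖x‖ := by
          refine (norm_sum_le _ _).trans (Finset.sum_le_sum fun l _ => ?_)
          rw [norm_mul, Complex.norm_real, Real.norm_of_nonneg (hS0 k l)]
          exact mul_le_mul_of_nonneg_left (norm_le_pi_norm x l) (hS0 k l)
      _ = ‖x‖ := by rw [← Finset.sum_mul, hS1, one_mul]
  have hSB : S.map Complex.ofReal = 1 + (h : ℂ) • B := by
    ext k l
    by_cases hkl : k = l <;> simp [hS, hB, hkl]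
  have hiter : ∀ N : ℕ, ‖v + ((N : ℂ) * h) • (B *ᵥ v)‖ ≤ ‖v‖ := by
    intro N
    induction N with
    | zero => simp
    | succ N ih =>
      refine le_trans (le_of_eq ?_) ((hcontr _).trans ih)
      congr 1
      rw [hSB, add_mulVec, one_mulVec, smul_mulVec, mulVec_add, mulVec_smul, hv, smul_zero,
        add_zero, add_assoc, ← add_smul]
      congr 2
      push_cast
      ring
  by_contra hne
  have hBv : 0 < h * ‖B *ᵥ v‖ := mul_pos hpos (norm_pos_iff.2 hne)
  obtain ⟨N, hN⟩ := exists_nat_gt ((2 * ‖v‖) / (h * ‖B *ᵥ v‖))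
  rw [div_lt_iff₀ hBv] at hN
  have h1 := norm_sub_le (v + ((N : ℂ) * h) • (B *ᵥ v)) v
  rw [add_sub_cancel_left, norm_smul, norm_mul, Complex.norm_natCast, Complex.norm_real,
    Real.norm_of_nonneg hpos.le, mul_assoc] at h1
  linarith [hiter N]

theorem Matrix.map_ofReal_exp (A : Matrix (Fin n) (Fin n) ℝ) :
    (NormedSpace.exp A).map Complex.ofReal = NormedSpace.exp (A.map Complex.ofReal) := by
  let : NormedRing (Matrix (Fin n) (Fin n) ℝ) := Matrix.linftyOpNormedRing
  let : NormedAlgebra ℚ (Matrix (Fin n) (Fin n) ℝ) := Matrix.linftyOpNormedAlgebra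
  let : NormedRing (Matrix (Fin n) (Fin n) ℂ) := Matrix.linftyOpNormedRing
  let : NormedAlgebra ℝ (Matrix (Fin n) (Fin n) ℝ) := Matrix.linftyOpNormedAlgebra
  have : CompleteSpace (Matrix (Fin n) (Fin n) ℝ) := FiniteDimensional.complete ℝ _
  have hc : Continuous (Complex.ofRealHom.mapMatrix (m := Fin n)) := by
    refine continuous_pi fun k => continuous_pi fun l => ?_
    exact Complex.continuous_ofReal.comp ((continuous_apply l).comp (continuous_apply k))
  exact NormedSpace.map_exp (Complex.ofRealHom.mapMatrix (m := Fin n)) hc A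

/-- The semigroup generated by a Metzler matrix with zero row sums converges exponentially. -/
theorem Matrix.exists_exp_sub_le (hoff : ∀ k l, k ≠ l → 0 ≤ A k l)
    (hsum : ∀ k, ∑ l, A k l = 0) :
    ∃ (J : Matrix (Fin n) (Fin n) ℝ) (C ε : ℝ), 0 < ε ∧ ∀ t : ℝ, 0 ≤ t → ∀ k l,
      |(NormedSpace.exp (t • A) - J) k l| ≤ C * Real.exp (-ε * t) := by
  have hconv := fun l : Fin n => Matrix.expConverges_of_eigenvalues
    (B := A.map Complex.ofReal)
    (fun μ hμ => eigenvalue_eq_zero_or_re_neg hoff hsum hμ)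
    (fun v hv => mulVec_eq_zero_of_mulVec_mulVec_eq_zero hoff hsum hv) (Pi.single l 1)
  choose w C ε hε hw using hconv
  obtain ⟨δ, hδ, hδε⟩ : ∃ δ : ℝ, 0 < δ ∧ ∀ l, δ ≤ ε l := by
    rcases isEmpty_or_nonempty (Fin n) with he | he
    · exact ⟨1, one_pos, fun l => he.elim l⟩
    · obtain ⟨l, hl⟩ := Finite.exists_min ε
      exact ⟨ε l, hε l, hl⟩
  refine ⟨of fun k l => (w l k).re, ∑ l, |C l|, δ, hδ, fun t ht k l => ?_⟩
  have hsm : (t : ℂ) • A.map Complex.ofReal = (t • A).map Complex.ofReal := by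
    ext; simp
  have h1 := hw l t ht
  rw [hsm, ← map_ofReal_exp] at h1
  have h2 := (norm_le_pi_norm _ k).trans h1
  rw [mulVec_single_one, Pi.sub_apply] at h2
  have h3 := (Complex.abs_re_le_norm _).trans h2
  simp only [col_apply, map_apply, Complex.sub_re, Complex.ofReal_re] at h3
  calc _ ≤ C l * Real.exp (-ε l * t) := h3
    _ ≤ |C l| * Real.exp (-δ * t) := by
        gcongr
        · exact le_abs_self _
        · exact hδε l
    _ ≤ _ := by
        gcongr
        exact Finset.single_le_sum (f := fun l => |C l|) (fun _ _ => abs_nonneg _)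
          (Finset.mem_univ l)

end Compartmental

/-! ### The resolvent as a Laplace transform -/

section Laplace

variable {n : ℕ} {A : Matrix (Fin n) (Fin n) ℝ}

theorem Matrix.hasDerivAt_exp_smul_apply (A : Matrix (Fin n) (Fin n) ℝ) (t : ℝ) (k l : Fin n) :
    HasDerivAt (fun u : ℝ => NormedSpace.exp (u • A) k l)
      ((NormedSpace.exp (t • A) * A) k l) t := by
  let : NormedRing (Matrix (Fin n) (Fin n) ℝ) := Matrix.linftyOpNormedRing
  let : NormedAlgebra ℝ (Matrix (Fin n) (Fin n) ℝ) := Matrix.linftyOpNormedAlgebra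
  have h := hasDerivAt_exp_smul_const (𝕂 := ℝ) A t
  exact (LinearMap.toContinuousLinearMap
    (Matrix.entryLinearMap ℝ ℝ k l)).hasFDerivAt.comp_hasDerivAt t h

theorem Matrix.continuous_exp_smul (A : Matrix (Fin n) (Fin n) ℝ) :
    Continuous fun t : ℝ => NormedSpace.exp (t • A) :=
  continuous_pi fun k => continuous_pi fun l =>
    continuous_iff_continuousAt.2 fun t => (hasDerivAt_exp_smul_apply A t k l).continuousAt

theorem integrableOn_cexp_neg_mul {g : ℝ → ℝ} (hg : Continuous g) {K : ℝ}
    (hK : ∀ t, 0 ≤ t → |g t| ≤ K) {s : ℂ} (hs : 0 < s.re) :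
    IntegrableOn (fun t : ℝ => Complex.exp (-s * t) * (g t : ℂ)) (Set.Ioi 0) := by
  have hK' : 0 ≤ K := (abs_nonneg _).trans (hK 0 le_rfl)
  refine Integrable.mono' ((exp_neg_integrableOn_Ioi 0 hs).const_mul K) ?_ ?_
  · exact Continuous.aestronglyMeasurable (by fun_prop)
  · refine (ae_restrict_iff' measurableSet_Ioi).2 (Eventually.of_forall fun t ht => ?_)
    rw [norm_mul, Complex.norm_exp, Complex.norm_real, mul_comm]
    have : (-s * (t : ℂ)).re = -s.re * t := by simp
    rw [this]
    gcongr
    exact hK t (le_of_lt ht)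

/-- The Laplace transform of a bounded semigroup is the resolvent of its generator; it is stated
without inverses, as a left inverse of `s - A`. -/
theorem Matrix.laplace_exp_mul {K : ℝ}
    (hK : ∀ t : ℝ, 0 ≤ t → ∀ k l, |NormedSpace.exp (t • A) k l| ≤ K) {s : ℂ} (hs : 0 < s.re) :
    (of fun k l => ∫ t : ℝ in Set.Ioi 0,
      Complex.exp (-s * t) * (NormedSpace.exp (t • A) k l : ℂ)) *
        (s • (1 : Matrix (Fin n) (Fin n) ℂ) - A.map Complex.ofReal) = 1 := by
  have hcont : ∀ k l, Continuous fun t : ℝ => NormedSpace.exp (t • A) k l := fun k l =>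
    (continuous_exp_smul A).matrix_elem k l
  have hint : ∀ k l, IntegrableOn (fun t : ℝ =>
      Complex.exp (-s * t) * (NormedSpace.exp (t • A) k l : ℂ)) (Set.Ioi 0) := fun k l =>
    integrableOn_cexp_neg_mul (hcont k l) (fun t ht => hK t ht k l) hs
  ext k l
  set D : Matrix (Fin n) (Fin n) ℂ := s • 1 - A.map Complex.ofReal with hD
  -- `-exp (-s t) exp (t A)` is an antiderivative of `exp (-s t) exp (t A) (s - A)`.
  have hderiv : ∀ t : ℝ, HasDerivAt
      (fun t : ℝ => -(Complex.exp (-s * t) * (NormedSpace.exp (t • A) k l : ℂ)))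
      (∑ j, (Complex.exp (-s * t) * (NormedSpace.exp (t • A) k j : ℂ)) * D j l) t := by
    intro t
    have h1 : HasDerivAt (fun t : ℝ => Complex.exp (-s * t)) (Complex.exp (-s * t) * (-s)) t := by
      have := ((Complex.ofRealCLM.hasDerivAt (x := t)).const_mul (-s)).cexp
      simpa using this
    have h2 := (hasDerivAt_exp_smul_apply A t k l).ofReal_comp
    refine (h1.mul h2).neg.congr_deriv ?_
    rw [eq_comm]
    simp only [hD, sub_apply, smul_apply, one_apply, map_apply, mul_apply, smul_eq_mul, mul_sub,
      Finset.sum_sub_distrib, mul_ite, mul_one, mul_zero, Finset.sum_ite_eq',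
      Finset.mem_univ, if_true, Complex.ofReal_sum, Complex.ofReal_mul, Finset.mul_sum, mul_assoc]
    ring
  have htend : Tendsto (fun t : ℝ => -(Complex.exp (-s * t) * (NormedSpace.exp (t • A) k l : ℂ)))
      atTop (𝓝 0) := by
    rw [← neg_zero]
    refine Tendsto.neg (squeeze_zero_norm' (a := fun t : ℝ => Real.exp (-(s.re * t)) * K) ?_ ?_)
    · filter_upwards [eventually_ge_atTop 0] with t ht
      rw [norm_mul, Complex.norm_exp, Complex.norm_real]
      have : (-s * (t : ℂ)).re = -(s.re * t) := by simp
      rw [this]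
      gcongr
      exact hK t ht k l
    · have := (Real.tendsto_exp_neg_atTop_nhds_zero.comp
        (tendsto_id.const_mul_atTop hs)).mul_const K
      simpa using this
  have h := integral_Ioi_of_hasDerivAt_of_tendsto (a := 0)
    (hderiv 0).continuousAt.continuousWithinAt (fun t _ => hderiv t)
    (integrable_finsetSum _ fun j _ => (hint k j).mul_const (D j l)) htend
  rw [integral_finsetSum _ fun j _ => (hint k j).mul_const (D j l)] at h
  simp only [integral_mul_const] at h
  rw [mul_apply]
  simp only [of_apply]
  rw [h]
  simp [Matrix.one_apply, apply_ite]

theorem Matrix.isUnit_det_smul_one_sub {K : ℝ}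
    (hK : ∀ t : ℝ, 0 ≤ t → ∀ k l, |NormedSpace.exp (t • A) k l| ≤ K) {s : ℂ} (hs : 0 < s.re) :
    IsUnit (s • (1 : Matrix (Fin n) (Fin n) ℂ) - A.map Complex.ofReal).det :=
  isUnit_det_of_left_inverse (laplace_exp_mul hK hs)

theorem Matrix.inv_smul_one_sub_apply {K : ℝ}
    (hK : ∀ t : ℝ, 0 ≤ t → ∀ k l, |NormedSpace.exp (t • A) k l| ≤ K) {s : ℂ} (hs : 0 < s.re)
    (k l : Fin n) :
    (s • (1 : Matrix (Fin n) (Fin n) ℂ) - A.map Complex.ofReal)⁻¹ k l =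
      ∫ t : ℝ in Set.Ioi 0, Complex.exp (-s * t) * (NormedSpace.exp (t • A) k l : ℂ) := by
  rw [inv_eq_left_inv (laplace_exp_mul hK hs), of_apply]

end Laplace

/-! ### The `ℋ₂` norm of a transfer function -/

section PaleyWiener

open FourierTransform in
/-- Plancherel's theorem for the Laplace transform along a vertical line of the right half
plane. -/
theorem lintegral_enorm_laplace_sq {g : ℝ → ℝ} (hg : Continuous g) {K : ℝ}
    (hK : ∀ t, 0 ≤ t → |g t| ≤ K) {σ : ℝ} (hσ : 0 < σ) :
    ENNReal.ofReal (1 / (2 * Real.pi)) * ∫⁻ ω : ℝ, ‖∫ t : ℝ in Set.Ioi 0,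
      Complex.exp (-((σ : ℂ) + (ω : ℂ) * Complex.I) * t) * (g t : ℂ)‖ₑ ^ 2 =
    ∫⁻ t in Set.Ioi (0 : ℝ), ENNReal.ofReal (Real.exp (-(2 * σ) * t)) * ‖g t‖ₑ ^ 2 := by
  -- The Laplace transform of `g` at `σ + i ω` is the Fourier transform at `ω / 2π` of the damped
  -- causal signal `f`.
  set f : ℝ → ℂ := (Set.Ioi (0 : ℝ)).indicator
    (fun t : ℝ => Complex.exp (-(σ : ℂ) * t) * (g t : ℂ)) with hf
  have hf1 : Integrable f :=
    (integrable_indicator_iff measurableSet_Ioi).2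
      (integrableOn_cexp_neg_mul hg hK (s := (σ : ℂ)) (by simpa using hσ))
  have hsq : ∀ t, ‖f t‖ₑ ^ 2 = (Set.Ioi (0 : ℝ)).indicator
      (fun t => ENNReal.ofReal (Real.exp (-(2 * σ) * t)) * ‖g t‖ₑ ^ 2) t := by
    intro t
    by_cases ht : t ∈ Set.Ioi (0 : ℝ)
    · rw [hf, Set.indicator_of_mem ht, Set.indicator_of_mem ht, enorm_mul, mul_pow]
      congr 1
      · rw [← ofReal_norm, Complex.norm_exp, ← ENNReal.ofReal_pow (by positivity),
          ← Real.exp_nat_mul]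
        congr 2
        simp
        ring
      · rw [← ofReal_norm, ← ofReal_norm, Complex.norm_real]
    · simp [hf, Set.indicator_of_notMem ht]
  have hf2 : MemLp f 2 := by
    rw [memLp_two_iff_integrable_sq_norm hf1.1]
    have hbd : ∀ t, ‖f t‖ ≤ K := by
      intro t
      by_cases ht : t ∈ Set.Ioi (0 : ℝ)
      · rw [hf, Set.indicator_of_mem ht, norm_mul, Complex.norm_exp, Complex.norm_real]
        have h1 : Real.exp (-(σ : ℂ) * t).re ≤ 1 := by
          rw [Real.exp_le_one_iff]
          have : 0 ≤ σ * t := mul_nonneg hσ.le (le_of_lt ht)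
          simpa using this
        calc _ ≤ 1 * K := by
              gcongr
              exact hK t (le_of_lt ht)
          _ = K := one_mul K
      · rw [hf, Set.indicator_of_notMem ht, norm_zero]
        exact (abs_nonneg _).trans (hK 0 le_rfl)
    refine (hf1.norm.const_mul K).mono' (hf1.1.norm.pow 2) (Eventually.of_forall fun t => ?_)
    rw [Real.norm_of_nonneg (by positivity), pow_two]
    exact mul_le_mul_of_nonneg_right (hbd t) (norm_nonneg _)
  have hFour : ∀ ω : ℝ, ∫ t : ℝ in Set.Ioi 0,
      Complex.exp (-((σ : ℂ) + (ω : ℂ) * Complex.I) * t) * (g t : ℂ) =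
        𝓕 f ((2 * Real.pi)⁻¹ * ω) := by
    intro ω
    rw [Real.fourier_real_eq_integral_exp_smul, ← integral_indicator measurableSet_Ioi]
    refine integral_congr_ae (Eventually.of_forall fun t => ?_)
    by_cases ht : t ∈ Set.Ioi (0 : ℝ)
    · simp only [hf, Set.indicator_of_mem ht, smul_eq_mul]
      rw [← mul_assoc, ← Complex.exp_add]
      congr 2
      push_cast
      have : (Real.pi : ℂ) ≠ 0 := by exact_mod_cast Real.pi_ne_zero
      field_simp
      ring
    · simp [hf, Set.indicator_of_notMem ht]
  simp_rw [hFour]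
  have hpi : (0 : ℝ) < (2 * Real.pi)⁻¹ := by positivity
  have hmeas : Measurable fun ξ : ℝ => ‖𝓕 f ξ‖ₑ ^ 2 :=
    ((VectorFourier.fourierIntegral_continuous Real.continuous_fourierChar
      (by exact continuous_inner) hf1).measurable.enorm.pow_const 2)
  have hscale := Real.smul_map_volume_mul_left hpi.ne'
  have h2 : ∫⁻ ξ, ‖𝓕 f ξ‖ₑ ^ 2 = ENNReal.ofReal (1 / (2 * Real.pi)) *
      ∫⁻ ω : ℝ, ‖𝓕 f ((2 * Real.pi)⁻¹ * ω)‖ₑ ^ 2 := by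
    conv_lhs => rw [← hscale]
    rw [lintegral_smul_measure, lintegral_map hmeas (measurable_const_mul _),
      abs_of_pos hpi, one_div, smul_eq_mul]
  rw [← h2, hf2.lintegral_enorm_fourier_sq hf1, ← lintegral_indicator measurableSet_Ioi]
  exact lintegral_congr hsq

/-- The exponential damping can be removed: the bound from below is Fatou's lemma along
`σ = 1 / (k + 1)`. -/
theorem iSup_lintegral_exp_mul {u : ℝ → ℝ≥0∞} (hu : Measurable u) :
    ⨆ (σ : ℝ) (_ : 0 < σ), ∫⁻ t in Set.Ioi (0 : ℝ),
      ENNReal.ofReal (Real.exp (-(2 * σ) * t)) * u t = ∫⁻ t in Set.Ioi (0 : ℝ), u t := by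
  apply le_antisymm
  · refine iSup₂_le fun σ hσ => setLIntegral_mono' measurableSet_Ioi fun t ht => ?_
    have h1 : Real.exp (-(2 * σ) * t) ≤ 1 := by
      rw [Real.exp_le_one_iff]
      have : 0 ≤ σ * t := mul_nonneg hσ.le (le_of_lt ht)
      linarith
    calc _ ≤ 1 * u t := by
          gcongr
          exact ENNReal.ofReal_le_one.2 h1
      _ = u t := one_mul _
  · set σ : ℕ → ℝ := fun k => 1 / ((k : ℝ) + 1) with hσ
    have hpos : ∀ k, 0 < σ k := fun k => by positivity
    have hlim : ∀ t, Tendsto (fun k => ENNReal.ofReal (Real.exp (-(2 * σ k) * t)) * u t) atTop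
        (𝓝 (u t)) := by
      intro t
      have h1 : Tendsto (fun k => ENNReal.ofReal (Real.exp (-(2 * σ k) * t))) atTop (𝓝 1) := by
        have h0 : Tendsto σ atTop (𝓝 0) := tendsto_one_div_add_atTop_nhds_zero_nat
        have hc : Continuous fun x : ℝ => ENNReal.ofReal (Real.exp (-(2 * x) * t)) :=
          ENNReal.continuous_ofReal.comp (by fun_prop)
        have h2 := (hc.tendsto 0).comp h0
        rw [mul_zero, neg_zero, zero_mul, Real.exp_zero, ENNReal.ofReal_one] at h2
        exact h2
      simpa using ENNReal.Tendsto.mul_const h1 (Or.inl one_ne_zero)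
    calc ∫⁻ t in Set.Ioi (0 : ℝ), u t
        = ∫⁻ t in Set.Ioi (0 : ℝ), liminf
            (fun k => ENNReal.ofReal (Real.exp (-(2 * σ k) * t)) * u t) atTop :=
          lintegral_congr fun t => (hlim t).liminf_eq.symm
      _ ≤ liminf (fun k => ∫⁻ t in Set.Ioi (0 : ℝ),
            ENNReal.ofReal (Real.exp (-(2 * σ k) * t)) * u t) atTop :=
          lintegral_liminf_le fun k => by
            exact (Measurable.ennreal_ofReal (by fun_prop)).mul hu
      _ ≤ _ := by
          refine liminf_le_of_le (by isBoundedDefault) fun b hb => ?_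
          obtain ⟨k, hk⟩ := hb.exists
          exact hk.trans (le_iSup₂_of_le (σ k) (hpos k) le_rfl)

variable {n : ℕ} {A : Matrix (Fin n) (Fin n) ℝ} {ι κ : Type}

/-- The transfer function `B₁ (s - A)⁻¹ B₂` is the Laplace transform of the impulse response. -/
theorem Matrix.mul_inv_mul_apply_eq_laplace {K : ℝ}
    (hK : ∀ t : ℝ, 0 ≤ t → ∀ k l, |NormedSpace.exp (t • A) k l| ≤ K)
    (B₁ : Matrix ι (Fin n) ℝ) (B₂ : Matrix (Fin n) κ ℝ) {s : ℂ} (hs : 0 < s.re) (a : ι) (b : κ) :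
    (B₁.map Complex.ofReal * (s • (1 : Matrix (Fin n) (Fin n) ℂ) - A.map Complex.ofReal)⁻¹ *
      B₂.map Complex.ofReal) a b =
    ∫ t : ℝ in Set.Ioi 0,
      Complex.exp (-s * t) * ((B₁ * NormedSpace.exp (t • A) * B₂) a b : ℂ) := by
  have hint : ∀ k l, IntegrableOn (fun t : ℝ =>
      Complex.exp (-s * t) * (NormedSpace.exp (t • A) k l : ℂ)) (Set.Ioi 0) := fun k l =>
    integrableOn_cexp_neg_mul ((continuous_exp_smul A).matrix_elem k l)
      (fun t ht => hK t ht k l) hs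
  have hpt : ∀ t : ℝ, Complex.exp (-s * t) * ((B₁ * NormedSpace.exp (t • A) * B₂) a b : ℂ) =
      ∑ l, ∑ k, (B₁ a k : ℂ) *
        (Complex.exp (-s * t) * (NormedSpace.exp (t • A) k l : ℂ)) * (B₂ l b : ℂ) := by
    intro t
    simp only [mul_apply, Finset.sum_mul, Finset.mul_sum, Complex.ofReal_sum, Complex.ofReal_mul]
    refine Finset.sum_congr rfl fun l _ => Finset.sum_congr rfl fun k _ => by ring
  simp_rw [hpt]
  rw [integral_finsetSum _ fun l _ => integrable_finsetSum _ fun k _ =>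
    ((hint k l).const_mul _).mul_const _]
  rw [mul_apply]
  refine Finset.sum_congr rfl fun l _ => ?_
  rw [integral_finsetSum _ fun k _ => ((hint k l).const_mul _).mul_const _, mul_apply,
    Finset.sum_mul]
  refine Finset.sum_congr rfl fun k _ => ?_
  rw [integral_mul_const, integral_const_mul, inv_smul_one_sub_apply hK hs, map_apply, map_apply]

theorem Matrix.exists_abs_mul_mul_apply_le {E : ℝ → Matrix (Fin n) (Fin n) ℝ} {K : ℝ}
    (hK : ∀ t : ℝ, 0 ≤ t → ∀ k l, |E t k l| ≤ K)
    (B₁ : Matrix ι (Fin n) ℝ) (B₂ : Matrix (Fin n) κ ℝ) (a : ι) (b : κ) :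
    ∃ K', ∀ t : ℝ, 0 ≤ t → |(B₁ * E t * B₂) a b| ≤ K' := by
  refine ⟨∑ l, ∑ k, |B₁ a k| * K * |B₂ l b|, fun t ht => ?_⟩
  simp only [mul_apply, Finset.sum_mul]
  refine (Finset.abs_sum_le_sum_abs _ _).trans (Finset.sum_le_sum fun l _ =>
    (Finset.abs_sum_le_sum_abs _ _).trans (Finset.sum_le_sum fun k _ => ?_))
  rw [abs_mul, abs_mul]
  gcongr
  exact hK t ht k l

theorem differentiableOn_mul_inv_mul_apply {K : ℝ}
    (hK : ∀ t : ℝ, 0 ≤ t → ∀ k l, |NormedSpace.exp (t • A) k l| ≤ K)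
    (B₁ : Matrix ι (Fin n) ℝ) (B₂ : Matrix (Fin n) κ ℝ) {G : ℂ → Matrix ι κ ℂ}
    (hG : ∀ s : ℂ, 0 < s.re → G s = B₁.map Complex.ofReal *
      (s • (1 : Matrix (Fin n) (Fin n) ℂ) - A.map Complex.ofReal)⁻¹ * B₂.map Complex.ofReal)
    (a : ι) (b : κ) : DifferentiableOn ℂ (fun s => G s a b) {s : ℂ | 0 < s.re} := by
  let : NormedRing (Matrix (Fin n) (Fin n) ℂ) := Matrix.linftyOpNormedRing
  let : NormedAlgebra ℂ (Matrix (Fin n) (Fin n) ℂ) := Matrix.linftyOpNormedAlgebra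
  have : CompleteSpace (Matrix (Fin n) (Fin n) ℂ) := FiniteDimensional.complete ℂ _
  have hentry : ∀ k l, DifferentiableOn ℂ
      (fun s : ℂ => (s • (1 : Matrix (Fin n) (Fin n) ℂ) - A.map Complex.ofReal)⁻¹ k l)
      {s : ℂ | 0 < s.re} := by
    intro k l s hs
    have hu : IsUnit (s • (1 : Matrix (Fin n) (Fin n) ℂ) - A.map Complex.ofReal) :=
      (isUnit_iff_isUnit_det _).2 (isUnit_det_smul_one_sub hK hs)
    obtain ⟨u, hu⟩ := hu
    have h1 : DifferentiableAt ℂ Ring.inverse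
        (s • (1 : Matrix (Fin n) (Fin n) ℂ) - A.map Complex.ofReal) := by
      rw [← hu]; exact differentiableAt_inverse u.isUnit
    have h2 : DifferentiableAt ℂ
        (fun s : ℂ => s • (1 : Matrix (Fin n) (Fin n) ℂ) - A.map Complex.ofReal) s := by
      fun_prop
    have h3 := (LinearMap.toContinuousLinearMap
      (Matrix.entryLinearMap ℂ ℂ k l)).differentiableAt.comp s (h1.comp s h2)
    refine (h3.congr_of_eventuallyEq (Eventually.of_forall fun z => ?_)).differentiableWithinAt
    simp [nonsing_inv_eq_ringInverse]
  refine DifferentiableOn.congr (f := fun s => ∑ l, (∑ k, (B₁ a k : ℂ) *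
    (s • (1 : Matrix (Fin n) (Fin n) ℂ) - A.map Complex.ofReal)⁻¹ k l) * (B₂ l b : ℂ)) ?_ ?_
  · exact DifferentiableOn.fun_sum fun l _ => DifferentiableOn.mul_const
      (DifferentiableOn.fun_sum fun k _ => (hentry k l).const_mul _) _
  · intro s hs
    rw [hG s hs]
    simp [mul_apply]

/-- The `ℋ₂` norm of a transfer function is the `L²` norm of the impulse response. -/
theorem h2Norm_eq_lintegral [Fintype ι] [Fintype κ] {K : ℝ}
    (hK : ∀ t : ℝ, 0 ≤ t → ∀ k l, |NormedSpace.exp (t • A) k l| ≤ K)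
    (B₁ : Matrix ι (Fin n) ℝ) (B₂ : Matrix (Fin n) κ ℝ) {G : ℂ → Matrix ι κ ℂ}
    (hG : ∀ s : ℂ, 0 < s.re → G s = B₁.map Complex.ofReal *
      (s • (1 : Matrix (Fin n) (Fin n) ℂ) - A.map Complex.ofReal)⁻¹ * B₂.map Complex.ofReal) :
    h2Norm G = (∫⁻ t in Set.Ioi (0 : ℝ),
      ∑ a, ∑ b, ‖(B₁ * NormedSpace.exp (t • A) * B₂) a b‖ₑ ^ 2) ^ (1 / 2 : ℝ) := by
  have hcont : ∀ a b, Continuous fun t : ℝ => (B₁ * NormedSpace.exp (t • A) * B₂) a b :=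
    fun a b => ((continuous_const.matrix_mul (continuous_exp_smul A)).matrix_mul
      continuous_const).matrix_elem a b
  have hmeas : ∀ a b, Measurable fun t : ℝ =>
      ‖(B₁ * NormedSpace.exp (t • A) * B₂) a b‖ₑ ^ 2 :=
    fun a b => (hcont a b).measurable.enorm.pow_const 2
  unfold h2Norm
  congr 1
  rw [← iSup_lintegral_exp_mul (Finset.measurable_fun_sum _ fun a _ =>
    Finset.measurable_fun_sum _ fun b _ => hmeas a b)]
  refine iSup_congr fun σ => iSup_congr fun hσ => ?_
  have hre : ∀ ω : ℝ, 0 < ((σ : ℂ) + (ω : ℂ) * Complex.I).re := fun ω => by simpa using hσ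
  have hcontG : ∀ a b, Measurable fun ω : ℝ =>
      ‖G ((σ : ℂ) + (ω : ℂ) * Complex.I) a b‖ₑ ^ 2 := by
    intro a b
    have hc : Continuous fun ω : ℝ => G ((σ : ℂ) + (ω : ℂ) * Complex.I) a b :=
      (differentiableOn_mul_inv_mul_apply hK B₁ B₂ hG a b).continuousOn.comp_continuous
        (by fun_prop) hre
    exact hc.measurable.enorm.pow_const 2
  have hmeas' : ∀ a b, Measurable fun t : ℝ => ENNReal.ofReal (Real.exp (-(2 * σ) * t)) *
      ‖(B₁ * NormedSpace.exp (t • A) * B₂) a b‖ₑ ^ 2 := fun a b =>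
    (Measurable.ennreal_ofReal (by fun_prop)).mul (hmeas a b)
  simp only [Finset.mul_sum]
  rw [lintegral_finsetSum _ fun a _ => Finset.measurable_fun_sum _ fun b _ => hcontG a b,
    lintegral_finsetSum _ fun a _ => Finset.measurable_fun_sum _ fun b _ => hmeas' a b,
    Finset.mul_sum]
  refine Finset.sum_congr rfl fun a _ => ?_
  rw [lintegral_finsetSum _ fun b _ => hcontG a b,
    lintegral_finsetSum _ fun b _ => hmeas' a b, Finset.mul_sum]
  refine Finset.sum_congr rfl fun b _ => ?_
  obtain ⟨K', hK'⟩ := exists_abs_mul_mul_apply_le hK B₁ B₂ a b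
  rw [← lintegral_enorm_laplace_sq (hcont a b) hK' hσ]
  simp_rw [hG _ (hre _), mul_inv_mul_apply_eq_laplace hK B₁ B₂ (hre _) a b]

end PaleyWiener

/-! ### The limit of the semigroup -/

section LimitMatrix

variable {n : ℕ} {A J : Matrix (Fin n) (Fin n) ℝ}

theorem Matrix.tendsto_exp_smul {C ε : ℝ} (hε : 0 < ε) (hJ : ∀ t : ℝ, 0 ≤ t → ∀ k l,
    |(NormedSpace.exp (t • A) - J) k l| ≤ C * Real.exp (-ε * t)) :
    Tendsto (fun t : ℝ => NormedSpace.exp (t • A)) atTop (𝓝 J) := by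
  refine tendsto_pi_nhds.2 fun k => tendsto_pi_nhds.2 fun l => ?_
  rw [tendsto_iff_norm_sub_tendsto_zero]
  refine squeeze_zero' (g := fun t : ℝ => C * Real.exp (-(ε * t)))
    (Eventually.of_forall fun _ => norm_nonneg _) ?_ ?_
  · filter_upwards [eventually_ge_atTop 0] with t ht
    have := hJ t ht k l
    rwa [neg_mul] at this
  · have := (Real.tendsto_exp_neg_atTop_nhds_zero.comp
      (tendsto_id.const_mul_atTop hε)).const_mul C
    simpa using this

theorem Matrix.exp_add_smul (A : Matrix (Fin n) (Fin n) ℝ) (u t : ℝ) :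
    NormedSpace.exp ((u + t) • A) = NormedSpace.exp (u • A) * NormedSpace.exp (t • A) := by
  rw [add_smul, exp_add_of_commute _ _ (((Commute.refl A).smul_left u).smul_right t)]

/-- The limit of the semigroup is invariant under the semigroup, so its columns lie in the kernel
of the generator. -/
theorem Matrix.mul_eq_zero_of_tendsto_exp
    (h : Tendsto (fun t : ℝ => NormedSpace.exp (t • A)) atTop (𝓝 J)) : A * J = 0 := by
  have hinv : ∀ u : ℝ, NormedSpace.exp (u • A) * J = J := by
    intro u
    have h1 : Tendsto (fun t : ℝ => NormedSpace.exp (u • A) * NormedSpace.exp (t • A)) atTop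
        (𝓝 (NormedSpace.exp (u • A) * J)) := h.const_mul _
    simp_rw [← exp_add_smul] at h1
    exact tendsto_nhds_unique h1 (h.comp (tendsto_atTop_add_const_left _ u tendsto_id))
  ext k l
  have hd : HasDerivAt (fun u : ℝ => ∑ j, NormedSpace.exp (u • A) k j * J j l)
      (∑ j, (NormedSpace.exp ((0 : ℝ) • A) * A) k j * J j l) 0 :=
    HasDerivAt.fun_sum fun j _ => (hasDerivAt_exp_smul_apply A 0 k j).mul_const _
  have hc : (fun u : ℝ => ∑ j, NormedSpace.exp (u • A) k j * J j l) = fun _ => J k l := by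
    ext u
    rw [← mul_apply, hinv]
  rw [hc] at hd
  have := hd.unique (hasDerivAt_const _ _)
  rw [zero_smul, NormedSpace.exp_zero, Matrix.one_mul] at this
  exact this

theorem Matrix.tendsto_exp_transpose
    (h : Tendsto (fun t : ℝ => NormedSpace.exp (t • A)) atTop (𝓝 J)) :
    Tendsto (fun t : ℝ => NormedSpace.exp (t • Aᵀ)) atTop (𝓝 Jᵀ) := by
  have : (fun t : ℝ => NormedSpace.exp (t • Aᵀ)) = fun t => (NormedSpace.exp (t • A))ᵀ := by
    ext1 t
    rw [← exp_transpose, transpose_smul]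
  rw [this]
  exact ((continuous_id.matrix_transpose).tendsto J).comp h

theorem Matrix.limit_mul_eq_zero_of_tendsto_exp
    (h : Tendsto (fun t : ℝ => NormedSpace.exp (t • A)) atTop (𝓝 J)) : J * A = 0 := by
  have := mul_eq_zero_of_tendsto_exp (tendsto_exp_transpose h)
  rw [← transpose_mul, transpose_eq_zero] at this
  exact this

end LimitMatrix

/-! ### Quadratic forms of Gramians -/

section Gramian

variable {n : ℕ} {κ : Type} [Fintype κ] {Z : ℝ → Matrix (Fin n) κ ℝ} {K ε : ℝ}

theorem integrableOn_mul_of_exp_decay {f g : ℝ → ℝ} (hf : Continuous f) (hg : Continuous g)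
    {K K' ε : ℝ} (hε : 0 < ε) (hfK : ∀ t, 0 ≤ t → |f t| ≤ K * Real.exp (-ε * t))
    (hgK : ∀ t, 0 ≤ t → |g t| ≤ K' * Real.exp (-ε * t)) :
    IntegrableOn (fun t => f t * g t) (Set.Ioi 0) := by
  have h2 : 0 < ε + ε := by linarith
  refine Integrable.mono' ((exp_neg_integrableOn_Ioi 0 h2).const_mul (K * K'))
    (hf.mul hg).aestronglyMeasurable ?_
  refine (ae_restrict_iff' measurableSet_Ioi).2 (Eventually.of_forall fun t ht => ?_)
  rw [norm_mul, neg_add, add_mul, Real.exp_add]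
  calc ‖f t‖ * ‖g t‖ ≤ (K * Real.exp (-ε * t)) * (K' * Real.exp (-ε * t)) :=
        mul_le_mul (hfK t (le_of_lt ht)) (hgK t (le_of_lt ht)) (norm_nonneg _)
          ((abs_nonneg _).trans (hfK t (le_of_lt ht)))
    _ = _ := by ring

theorem integrableOn_mul_transpose_apply (hZ : Continuous Z) (hε : 0 < ε)
    (hK : ∀ t, 0 ≤ t → ∀ k b, |Z t k b| ≤ K * Real.exp (-ε * t)) (k l : Fin n) :
    IntegrableOn (fun t => (Z t * (Z t)ᵀ) k l) (Set.Ioi 0) := by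
  simp only [mul_apply, transpose_apply]
  exact integrable_finsetSum _ fun b _ => integrableOn_mul_of_exp_decay (hZ.matrix_elem k b)
    (hZ.matrix_elem l b) hε (fun t ht => hK t ht k b) fun t ht => hK t ht l b

theorem Matrix.dotProduct_mul_transpose_mulVec (v : Fin n → ℝ) (X : Matrix (Fin n) κ ℝ) :
    v ⬝ᵥ (X * Xᵀ) *ᵥ v = ∑ b, (v ᵥ* X) b ^ 2 := by
  rw [← mulVec_mulVec, dotProduct_mulVec, mulVec_transpose, dotProduct]
  exact Finset.sum_congr rfl fun b _ => (pow_two _).symm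

/-- The quadratic form of a Gramian `∫ Z Zᵀ` at `v` is the squared `L²` norm of `vᵀ Z`. -/
theorem dotProduct_gramian_mulVec (hZ : Continuous Z) (hε : 0 < ε)
    (hK : ∀ t, 0 ≤ t → ∀ k b, |Z t k b| ≤ K * Real.exp (-ε * t)) (v : Fin n → ℝ) :
    (0 ≤ v ⬝ᵥ (of fun k l => ∫ t in Set.Ioi (0 : ℝ), (Z t * (Z t)ᵀ) k l) *ᵥ v) ∧
      ENNReal.ofReal (v ⬝ᵥ (of fun k l => ∫ t in Set.Ioi (0 : ℝ), (Z t * (Z t)ᵀ) k l) *ᵥ v) =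
        ∫⁻ t in Set.Ioi (0 : ℝ), ∑ b, ‖(v ᵥ* Z t) b‖ₑ ^ 2 := by
  have hint := integrableOn_mul_transpose_apply hZ hε hK
  have hpt : ∀ t, ∑ k, v k * ∑ l, (Z t * (Z t)ᵀ) k l * v l = ∑ b, (v ᵥ* Z t) b ^ 2 :=
    fun t => dotProduct_mul_transpose_mulVec v (Z t)
  have hint' : ∀ k, IntegrableOn (fun t => v k * ∑ l, (Z t * (Z t)ᵀ) k l * v l) (Set.Ioi 0) :=
    fun k => (integrable_finsetSum _ fun l _ => (hint k l).mul_const _).const_mul _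
  have heq : v ⬝ᵥ (of fun k l => ∫ t in Set.Ioi (0 : ℝ), (Z t * (Z t)ᵀ) k l) *ᵥ v =
      ∫ t in Set.Ioi (0 : ℝ), ∑ b, (v ᵥ* Z t) b ^ 2 := by
    simp_rw [← hpt]
    rw [integral_finsetSum _ fun k _ => hint' k]
    refine Finset.sum_congr rfl fun k _ => ?_
    rw [integral_const_mul, integral_finsetSum _ fun l _ => (hint k l).mul_const _]
    simp only [integral_mul_const, mulVec, dotProduct, of_apply]
  have hint2 : IntegrableOn (fun t => ∑ b, (v ᵥ* Z t) b ^ 2) (Set.Ioi 0) := by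
    simp_rw [← hpt]
    exact integrable_finsetSum _ fun k _ => hint' k
  have hnn : ∀ t, 0 ≤ ∑ b, (v ᵥ* Z t) b ^ 2 := fun t => Finset.sum_nonneg fun b _ => sq_nonneg _
  rw [heq]
  refine ⟨integral_nonneg hnn, ?_⟩
  rw [ofReal_integral_eq_lintegral_ofReal hint2 (Eventually.of_forall hnn)]
  refine lintegral_congr fun t => ?_
  rw [ENNReal.ofReal_sum_of_nonneg fun b _ => sq_nonneg _]
  refine Finset.sum_congr rfl fun b _ => ?_
  rw [← ofReal_norm, ← ENNReal.ofReal_pow (norm_nonneg _), Real.norm_eq_abs, sq_abs]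

end Gramian

/-! ### The Gramian integrands -/

section ImpulseResponse

variable {n : ℕ} {A J : Matrix (Fin n) (Fin n) ℝ} {C ε : ℝ}

theorem Matrix.continuous_exp_sub_mul {κ : Type} (A J : Matrix (Fin n) (Fin n) ℝ)
    (B : Matrix (Fin n) κ ℝ) : Continuous fun t : ℝ => (NormedSpace.exp (t • A) - J) * B :=
  ((continuous_exp_smul A).sub continuous_const).matrix_mul continuous_const

theorem Matrix.abs_exp_sub_mul_apply_le {κ : Type} [Fintype κ] (hJ : ∀ t : ℝ, 0 ≤ t → ∀ k l,
    |(NormedSpace.exp (t • A) - J) k l| ≤ C * Real.exp (-ε * t)) (B : Matrix (Fin n) κ ℝ) :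
    ∃ K, ∀ t : ℝ, 0 ≤ t → ∀ k b,
      |((NormedSpace.exp (t • A) - J) * B) k b| ≤ K * Real.exp (-ε * t) := by
  refine ⟨∑ b, ∑ l, C * |B l b|, fun t ht k b => ?_⟩
  have hC : 0 ≤ C := by
    have := (abs_nonneg _).trans (hJ 0 le_rfl k k)
    simpa using this
  calc |∑ l, (NormedSpace.exp (t • A) - J) k l * B l b|
      ≤ ∑ l, C * |B l b| * Real.exp (-ε * t) := by
        refine (Finset.abs_sum_le_sum_abs _ _).trans (Finset.sum_le_sum fun l _ => ?_)
        rw [abs_mul, mul_right_comm]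
        exact mul_le_mul_of_nonneg_right (hJ t ht k l) (abs_nonneg _)
    _ = (∑ l, C * |B l b|) * Real.exp (-ε * t) := (Finset.sum_mul _ _ _).symm
    _ ≤ _ := by
        gcongr
        exact Finset.single_le_sum (f := fun b => ∑ l, C * |B l b|)
          (fun _ _ => Finset.sum_nonneg fun _ _ => by positivity) (Finset.mem_univ b)

theorem ctrlIntegrand_eq_mul_transpose {p : ℕ} (hlim : limitMatrix A = J)
    (B : Matrix (Fin n) (Fin p) ℝ) (t : ℝ) : ctrlIntegrand A B t =
      ((NormedSpace.exp (t • A) - J) * B) * ((NormedSpace.exp (t • A) - J) * B)ᵀ := by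
  rw [ctrlIntegrand, hlim, transpose_mul, transpose_sub, ← exp_transpose, transpose_smul,
    Matrix.mul_assoc (_ * B)]

theorem obsvIntegrand_eq_mul_transpose {q : ℕ} (hlim : limitMatrix A = J)
    (B : Matrix (Fin q) (Fin n) ℝ) (t : ℝ) : obsvIntegrand A B t =
      ((NormedSpace.exp (t • Aᵀ) - Jᵀ) * Bᵀ) * ((NormedSpace.exp (t • Aᵀ) - Jᵀ) * Bᵀ)ᵀ := by
  rw [obsvIntegrand, hlim, transpose_mul, transpose_sub, ← exp_transpose, transpose_smul,
    transpose_transpose, transpose_transpose, transpose_transpose, Matrix.mul_assoc (_ * Bᵀ)]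

end ImpulseResponse

/-! ### Network systems -/

section Network

theorem WeightedDigraph.neg_laplacian_offDiag_nonneg {n : ℕ} (G : WeightedDigraph n) (k l : Fin n)
    (h : k ≠ l) : 0 ≤ (-G.laplacian) k l := by
  simpa [laplacian, h] using G.w_nonneg k l

theorem WeightedDigraph.sum_neg_laplacian {n : ℕ} (G : WeightedDigraph n) (k : Fin n) :
    ∑ l, (-G.laplacian) k l = 0 := by
  simp [laplacian, Matrix.diagonal_apply]

namespace NetworkSystem

variable {n p q : ℕ} (Sys : NetworkSystem n p q) {m : Fin n → ℝ}

theorem pencil_eq (m : Fin n → ℝ) (s : ℂ) :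
    Sys.pencil m s = (Matrix.diagonal m).map Complex.ofReal *
      (s • (1 : Matrix (Fin n) (Fin n) ℂ) - (-Sys.graph.laplacian).map Complex.ofReal) := by
  have h : (Matrix.diagonal m * Sys.graph.laplacian).map Complex.ofReal =
      (Matrix.diagonal m).map Complex.ofReal * Sys.graph.laplacian.map Complex.ofReal :=
    Matrix.map_mul (f := Complex.ofRealHom)
  have h' : (-Sys.graph.laplacian).map Complex.ofReal =
      -(Sys.graph.laplacian.map Complex.ofReal) := by
    ext; simp
  rw [pencil, L, h, h', sub_neg_eq_add, mul_add, Matrix.mul_smul, mul_one]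

theorem diagonal_inv_mul_diagonal (hm : ∀ i, 0 < m i) :
    (Matrix.diagonal fun i => (m i)⁻¹).map Complex.ofReal *
      (Matrix.diagonal m).map Complex.ofReal = 1 := by
  rw [diagonal_map Complex.ofReal_zero, diagonal_map Complex.ofReal_zero, diagonal_mul_diagonal,
    ← diagonal_one]
  congr 1
  ext i
  have : (m i : ℂ) ≠ 0 := by exact_mod_cast (hm i).ne'
  simp [this]

theorem inv_pencil (hm : ∀ i, 0 < m i) (s : ℂ) :
    (Sys.pencil m s)⁻¹ =
      (s • (1 : Matrix (Fin n) (Fin n) ℂ) - (-Sys.graph.laplacian).map Complex.ofReal)⁻¹ *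
        (Matrix.diagonal fun i => (m i)⁻¹).map Complex.ofReal := by
  rw [pencil_eq, Matrix.mul_inv_rev, inv_eq_left_inv (diagonal_inv_mul_diagonal hm)]

theorem inputTransfer_eq (hm : ∀ i, 0 < m i) (i j : Fin n) (s : ℂ) :
    Sys.inputTransfer m i j s = (replicateRow Unit (eDiff i j)).map Complex.ofReal *
      (s • (1 : Matrix (Fin n) (Fin n) ℂ) - (-Sys.graph.laplacian).map Complex.ofReal)⁻¹ *
        Sys.F.map Complex.ofReal := by
  have h : (Matrix.diagonal m * Sys.F).map Complex.ofReal =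
      (Matrix.diagonal m).map Complex.ofReal * Sys.F.map Complex.ofReal :=
    Matrix.map_mul (f := Complex.ofRealHom)
  rw [inputTransfer, inv_pencil Sys hm, h, ← Matrix.mul_assoc, ← Matrix.mul_assoc,
    Matrix.mul_assoc _ (Matrix.map (diagonal fun i => (m i)⁻¹) _), diagonal_inv_mul_diagonal hm,
    Matrix.mul_one]

theorem outputTransfer_eq (hm : ∀ i, 0 < m i) (i j : Fin n) (s : ℂ) :
    Sys.outputTransfer m i j s = Sys.H.map Complex.ofReal *
      (s • (1 : Matrix (Fin n) (Fin n) ℂ) - (-Sys.graph.laplacian).map Complex.ofReal)⁻¹ *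
        (replicateCol Unit ((Matrix.diagonal m)⁻¹ *ᵥ eDiff i j)).map Complex.ofReal := by
  have hinv : (Matrix.diagonal m)⁻¹ = Matrix.diagonal fun i => (m i)⁻¹ := by
    refine inv_eq_left_inv ?_
    rw [diagonal_mul_diagonal, ← diagonal_one]
    congr 1
    ext i
    exact inv_mul_cancel₀ (hm i).ne'
  have h : (Matrix.diagonal fun i => (m i)⁻¹).map Complex.ofReal *
      (replicateCol Unit (eDiff i j)).map Complex.ofReal =
        (replicateCol Unit ((Matrix.diagonal m)⁻¹ *ᵥ eDiff i j)).map Complex.ofReal := by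
    rw [hinv, Matrix.replicateCol_mulVec]
    exact (Matrix.map_mul (f := Complex.ofRealHom)).symm
  rw [outputTransfer, inv_pencil Sys hm, ← h, ← Matrix.mul_assoc, ← Matrix.mul_assoc]

/-- Orthogonality to `ker L` removes the limit matrix from the input response. -/
theorem vecMul_eq_zero_of_clusterable {i j : Fin n} (hij : Sys.Clusterable m i j)
    {J : Matrix (Fin n) (Fin n) ℝ} (hJ : (-Sys.graph.laplacian) * J = 0) :
    eDiff i j ᵥ* J = 0 := by
  ext l
  refine hij.1 (J.col l) ?_
  rw [Matrix.neg_mul, neg_eq_zero] at hJ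
  rw [L, ← mulVec_mulVec]
  have : Sys.graph.laplacian *ᵥ J.col l = 0 := by
    ext k
    exact congrFun (congrFun hJ k) l
  rw [this, mulVec_zero]

/-- Orthogonality to `ker Lᵀ = M⁻¹ ker ℒᵀ` removes the limit matrix from the output response. -/
theorem mulVec_inv_eq_zero_of_clusterable (hm : ∀ i, 0 < m i) {i j : Fin n}
    (hij : Sys.Clusterable m i j) {J : Matrix (Fin n) (Fin n) ℝ}
    (hJ : J * (-Sys.graph.laplacian) = 0) :
    J *ᵥ ((Matrix.diagonal m)⁻¹ *ᵥ eDiff i j) = 0 := by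
  rw [Matrix.mul_neg, neg_eq_zero] at hJ
  have hu : IsUnit (Matrix.diagonal m).det := by
    rw [det_diagonal, isUnit_iff_ne_zero]
    exact Finset.prod_ne_zero_iff.2 fun i _ => (hm i).ne'
  ext k
  rw [mulVec_mulVec]
  have h := hij.2 ((J * (Matrix.diagonal m)⁻¹) k) (by
    rw [mulVec_transpose]
    have : J * (Matrix.diagonal m)⁻¹ * Sys.L m = 0 := by
      rw [L, ← Matrix.mul_assoc, Matrix.mul_assoc J, nonsing_inv_mul _ hu, Matrix.mul_one, hJ]
    exact congrFun this k)
  rw [dotProduct_comm] at h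
  exact h

end NetworkSystem

end Network

/-! ### The dissimilarity of clusterable vertices -/

theorem mainTheorem7 {n p q : ℕ} (Sys : NetworkSystem n p q)
    (hconn : Sys.graph.WeaklyConnected)
    (m : Fin n → ℝ) (hm : Sys.IsGeneralizedBalancedForm m)
    (i j : Fin n) (hij : Sys.Clusterable m i j) :
    -- the limit matrix and the two pseudo Gramians are well defined
    (Tendsto (fun τ : ℝ => NormedSpace.exp (τ • (-Sys.graph.laplacian))) atTop
        (𝓝 (limitMatrix (-Sys.graph.laplacian)))) ∧
    (∀ k l, IntegrableOn (fun τ => ctrlIntegrand (-Sys.graph.laplacian) Sys.F τ k l)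
        (Set.Ioi 0)) ∧
    (∀ k l, IntegrableOn (fun τ => obsvIntegrand (-Sys.graph.laplacian) Sys.H τ k l)
        (Set.Ioi 0)) ∧
    -- the two transfer functions are well defined and lie in the Hardy space
    (∀ s : ℂ, 0 < s.re → IsUnit (Sys.pencil m s).det) ∧
    MemH2 (Sys.inputTransfer m i j) ∧
    MemH2 (Sys.outputTransfer m i j) ∧
    -- the quantities under the square root are nonnegative, and the formula holds
    0 ≤ eDiff i j ⬝ᵥ Sys.P *ᵥ eDiff i j ∧
    0 ≤ eDiff i j ⬝ᵥ
      ((Matrix.diagonal m)⁻¹ * Sys.Q * (Matrix.diagonal m)⁻¹) *ᵥ eDiff i j ∧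
    Sys.dissimilarity m i j =
      ENNReal.ofReal (Real.sqrt
        ((eDiff i j ⬝ᵥ Sys.P *ᵥ eDiff i j) *
          (eDiff i j ⬝ᵥ
            ((Matrix.diagonal m)⁻¹ * Sys.Q * (Matrix.diagonal m)⁻¹) *ᵥ eDiff i j))) := by 
  obtain ⟨hmpos, -⟩ := hm
  set A := -Sys.graph.laplacian with hA
  obtain ⟨J, C, ε, hε, hJ⟩ := Matrix.exists_exp_sub_le (A := A)
    Sys.graph.neg_laplacian_offDiag_nonneg Sys.graph.sum_neg_laplacian
  have htend := Matrix.tendsto_exp_smul hε hJ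
  have hlim : limitMatrix A = J := htend.limUnder_eq
  have hJT : ∀ t : ℝ, 0 ≤ t → ∀ k l,
      |(NormedSpace.exp (t • Aᵀ) - Jᵀ) k l| ≤ C * Real.exp (-ε * t) := by
    intro t ht k l
    rw [← transpose_smul, exp_transpose]
    exact hJ t ht l k
  -- The Laplace transform only needs boundedness of the semigroup.
  obtain ⟨K, hK⟩ : ∃ K, ∀ t : ℝ, 0 ≤ t → ∀ k l, |NormedSpace.exp (t • A) k l| ≤ K := by
    refine ⟨C + ∑ k, ∑ l, |J k l|, fun t ht k l => ?_⟩
    have hC : 0 ≤ C := by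
      have := (abs_nonneg _).trans (hJ 0 le_rfl k k)
      simpa using this
    have h1 : C * Real.exp (-ε * t) ≤ C * 1 := by
      gcongr
      rw [Real.exp_le_one_iff, neg_mul, neg_nonpos]
      positivity
    have h2 : |J k l| ≤ ∑ k, ∑ l, |J k l| :=
      (Finset.single_le_sum (f := fun l => |J k l|) (fun _ _ => abs_nonneg _)
        (Finset.mem_univ l)).trans
      (Finset.single_le_sum (f := fun k => ∑ l, |J k l|)
        (fun _ _ => Finset.sum_nonneg fun _ _ => abs_nonneg _) (Finset.mem_univ k))
    have h3 : NormedSpace.exp (t • A) k l = (NormedSpace.exp (t • A) - J) k l + J k l := by simp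
    rw [h3]
    linarith [abs_add_le ((NormedSpace.exp (t • A) - J) k l) (J k l), hJ t ht k l]
  obtain ⟨K₁, hK₁⟩ := Matrix.abs_exp_sub_mul_apply_le hJ Sys.F
  obtain ⟨K₂, hK₂⟩ := Matrix.abs_exp_sub_mul_apply_le hJT Sys.Hᵀ
  have hc₁ := Matrix.continuous_exp_sub_mul A J Sys.F
  have hc₂ := Matrix.continuous_exp_sub_mul Aᵀ Jᵀ Sys.Hᵀ
  -- For `v = M⁻¹ e` the output transfer function is `H (s - A)⁻¹ v`; clusterability annihilates
  -- the limit matrix on both sides, so the impulse responses may be taken with `exp (t A) - J`.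
  set e := eDiff i j with he
  set v := (Matrix.diagonal m)⁻¹ *ᵥ e with hv
  have heJ : e ᵥ* J = 0 :=
    Sys.vecMul_eq_zero_of_clusterable hij (mul_eq_zero_of_tendsto_exp htend)
  have hJv : J *ᵥ v = 0 :=
    Sys.mulVec_inv_eq_zero_of_clusterable hmpos hij (limit_mul_eq_zero_of_tendsto_exp htend)
  obtain ⟨hP0, hP⟩ := dotProduct_gramian_mulVec hc₁ hε hK₁ e
  obtain ⟨hQ0, hQ⟩ := dotProduct_gramian_mulVec hc₂ hε hK₂ v
  have hPeq : Sys.P = of fun k l => ∫ t in Set.Ioi (0 : ℝ),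
      ((NormedSpace.exp (t • A) - J) * Sys.F * ((NormedSpace.exp (t • A) - J) * Sys.F)ᵀ) k l := by
    simp only [NetworkSystem.P, pseudoCtrlGramian, ← hA, ctrlIntegrand_eq_mul_transpose hlim]
  have hQeq : Sys.Q = of fun k l => ∫ t in Set.Ioi (0 : ℝ),
      ((NormedSpace.exp (t • Aᵀ) - Jᵀ) * Sys.Hᵀ *
        ((NormedSpace.exp (t • Aᵀ) - Jᵀ) * Sys.Hᵀ)ᵀ) k l := by
    simp only [NetworkSystem.Q, pseudoObsvGramian, ← hA, obsvIntegrand_eq_mul_transpose hlim]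
  rw [← hPeq] at hP0 hP
  rw [← hQeq] at hQ0 hQ
  have hQv : e ⬝ᵥ ((Matrix.diagonal m)⁻¹ * Sys.Q * (Matrix.diagonal m)⁻¹) *ᵥ e =
      v ⬝ᵥ Sys.Q *ᵥ v := by
    rw [← mulVec_mulVec, ← mulVec_mulVec, dotProduct_mulVec, ← mulVec_transpose,
      transpose_nonsing_inv, diagonal_transpose]
  have hI : Sys.inputDissimilarity m i j =
      ENNReal.ofReal (e ⬝ᵥ Sys.P *ᵥ e) ^ (1 / 2 : ℝ) := by
    rw [NetworkSystem.inputDissimilarity, h2Norm_eq_lintegral hK (replicateRow Unit e) Sys.F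
      fun s _ => Sys.inputTransfer_eq hmpos i j s, hP]
    congr 1
    refine lintegral_congr fun t => ?_
    rw [Fintype.sum_unique]
    refine Finset.sum_congr rfl fun b _ => ?_
    rw [Matrix.mul_assoc, ← replicateRow_vecMul, replicateRow_apply, Matrix.sub_mul,
      vecMul_sub, ← vecMul_vecMul e J, heJ, zero_vecMul, sub_zero]
  have hO : Sys.outputDissimilarity m i j =
      ENNReal.ofReal (v ⬝ᵥ Sys.Q *ᵥ v) ^ (1 / 2 : ℝ) := by
    rw [NetworkSystem.outputDissimilarity, h2Norm_eq_lintegral hK Sys.H (replicateCol Unit v)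
      fun s _ => Sys.outputTransfer_eq hmpos i j s, hQ]
    congr 1
    refine lintegral_congr fun t => Finset.sum_congr rfl fun a _ => ?_
    rw [Fintype.sum_unique, ← replicateCol_mulVec, replicateCol_apply, ← vecMul_vecMul,
      vecMul_sub, vecMul_transpose, vecMul_transpose, hJv, sub_zero, ← transpose_smul,
      exp_transpose, vecMul_transpose, mulVec_mulVec v Sys.H]
  have hfin : ∀ x : ℝ, ENNReal.ofReal x ^ (1 / 2 : ℝ) < ⊤ := fun x =>
    ENNReal.rpow_lt_top_of_nonneg (by norm_num) ENNReal.ofReal_ne_top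
  refine ⟨hlim ▸ htend, fun k l => ?_, fun k l => ?_, fun s hs => ?_, ⟨fun a b => ?_, ?_⟩,
    ⟨fun a b => ?_, ?_⟩, hP0, hQv ▸ hQ0, ?_⟩
  · simp only [ctrlIntegrand_eq_mul_transpose hlim]
    exact integrableOn_mul_transpose_apply hc₁ hε hK₁ k l
  · simp only [obsvIntegrand_eq_mul_transpose hlim]
    exact integrableOn_mul_transpose_apply hc₂ hε hK₂ k l
  · rw [NetworkSystem.pencil_eq, det_mul]
    exact (isUnit_det_of_left_inverse (NetworkSystem.diagonal_inv_mul_diagonal hmpos)).mul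
      (isUnit_det_smul_one_sub hK hs)
  · exact differentiableOn_mul_inv_mul_apply hK _ _
      (fun s _ => Sys.inputTransfer_eq hmpos i j s) a b
  · exact hI.trans_lt (hfin _)
  · exact differentiableOn_mul_inv_mul_apply hK _ _
      (fun s _ => Sys.outputTransfer_eq hmpos i j s) a b
  · exact hO.trans_lt (hfin _)
  · rw [NetworkSystem.dissimilarity, hI, hO, hQv,
      ENNReal.ofReal_rpow_of_nonneg hP0 (by norm_num),
      ENNReal.ofReal_rpow_of_nonneg hQ0 (by norm_num), ← ENNReal.ofReal_mul (by positivity),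
      Real.sqrt_mul hP0, Real.sqrt_eq_rpow, Real.sqrt_eq_rpow]
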